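/- Let $(W,S)$ be a Coxeter system with $S$ finite, length function $\ell$, and standard geometric representation on $V=\bigoplus_{s\in S}\mathbb{R}\alpha_s$, where $\langle\alpha_s,\alpha_t\rangle=-\cos(\pi/m(s,t))$ (equal to $-1$ if $m(s,t)=\infty$) and $sv=v-2\langle v,\alpha_s\rangle\alpha_s$. Let $\Phi=\{w\alpha_s\mid w\in W,\ s\in S\}$ be its root system, $\Phi^+$ (resp. $\Phi^-$) the set of roots all of whose coefficients in the basis $(\alpha_s)_{s\in S}$ are $\ge 0$ (resp. $\le 0$), and for $w\in W$ put $\Phi(w)=\{\alpha\in\Phi^+\mid w^{-1}\alpha\in\Phi^-\}$ and $\Phi^R(w)=\{-w\alpha_s\mid s\in S,\ \ell(ws)<\ell(w)\}$. Write $x\preceq y$ if $\ell(y)=\ell(x)+\ell(x^{-1}y)$. A subset $X\subseteq W$ is *gated* if it has a unique element $g$ of minimal length and $g\preceq y$ for all $y\in X$; then $g$ is the *gate* of $X$. It is *convex* if for all $x,y\in X$ and every reduced expression $x^{-1}y=s_1\cdots s_n$ the elements $xs_1\cdots s_j$ $(0\le j\le n)$ lie in $X$. The *cone type* of $w\in W$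 is $T(w)=\{v\in W\mid \ell(wv)=\ell(w)+\ell(v)\}$. For a cone type $T$ let $Q(T)=\{x\in W\mid T(x^{-1})=T\}$ and $$\partial T=\{\beta\in\Phi^+\mid \Phi(w)\cap\Phi(y)=\{\beta\}\text{ for some } w\in Q(T),\ y\in W\}.$$ Let $\Gamma$ be the set of gates of the sets $Q(T)$, for $T$ a cone type, and let $\Gamma^0=\{g\in\Gamma\mid |\Phi^R(g)|=1\}$ be the set of *tight gates*. For $x\in W$ and $\beta\in\Phi$ let $\partial T(x^{-1})_\beta=\{y\in W\mid \Phi(x)\cap\Phi(y)=\{\beta\}\}$ be the set of *witnesses* of $\beta$ with respect to $x$. **Theorem.** Let $x\in W$ and $\beta\in\partial T(x^{-1})$ (for instance, $\beta\in\Phi(x)$ such that $\Phi(x)\cap\Phi(y')=\{\beta\}$ for some $y'\in W$). Then there exists a unique minimal length element $y\in W$ such that $\Phi(x)\cap\Phi(y)=\{\beta\}$. Furthermore, $y\in\Gamma^0$, and the set $\partial T(x^{-1})_\beta$ is convex and gated. -/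

import Mathlib

/-! ## The geometric representation and the root system -/

namespace CoxeterMatrix

variable {B : Type*} (M : CoxeterMatrix B)

/-- The simple root `α_i`, a basis vector of the real vector space `V = B →₀ ℝ`. -/
noncomputable def simpleRoot (i : B) : B →₀ ℝ := Finsupp.single i 1

/-- The bilinear form on `V` with `⟨α_i, α_j⟩ = -cos (π / m(i, j))`. An infinite label is encoded
as `M i j = 0`, where `π / 0 = 0` yields the usual value `-1`. -/
noncomputable def rootForm : (B →₀ ℝ) →ₗ[ℝ] (B →₀ ℝ) →ₗ[ℝ] ℝ :=
  Finsupp.linearCombination ℝ fun i =>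
    Finsupp.linearCombination ℝ fun j => -Real.cos (Real.pi / (M i j : ℝ))

theorem rootForm_simpleRoot (i j : B) :
    M.rootForm (simpleRoot i) (simpleRoot j) = -Real.cos (Real.pi / (M i j : ℝ)) := by
  simp [rootForm, simpleRoot]

/-- The linear functional `v ↦ 2 ⟨v, α_i⟩`. -/
noncomputable def simpleCoroot (i : B) : Module.Dual ℝ (B →₀ ℝ) :=
  (2 : ℝ) • M.rootForm.flip (simpleRoot i)

theorem simpleCoroot_simpleRoot (i j : B) :
    M.simpleCoroot i (simpleRoot j) = -(2 * Real.cos (Real.pi / (M i j : ℝ))) := by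
  simp [simpleCoroot, rootForm_simpleRoot, M.symmetric j i]

theorem simpleCoroot_simpleRoot_self (i : B) : M.simpleCoroot i (simpleRoot i) = 2 := by
  simp [simpleCoroot_simpleRoot]

/-- The simple reflection `v ↦ v - 2 ⟨v, α_i⟩ α_i` of `V`. -/
noncomputable def simpleReflection (i : B) : (B →₀ ℝ) ≃ₗ[ℝ] (B →₀ ℝ) :=
  Module.reflection (M.simpleCoroot_simpleRoot_self i)

theorem simpleReflection_apply (i : B) (v : B →₀ ℝ) :
    M.simpleReflection i v = v - (2 * M.rootForm v (simpleRoot i)) • simpleRoot i := by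
  simp [simpleReflection, Module.reflection_apply, simpleCoroot]

/-- The simple reflections of `V` satisfy the Coxeter relations. -/
theorem isLiftable_simpleReflection : M.IsLiftable M.simpleReflection := by
  intro i j
  obtain hij | hij := eq_or_ne i j
  · subst hij
    rw [M.diagonal, pow_one]
    ext1 v
    exact Module.involutive_reflection (M.simpleCoroot_simpleRoot_self i) v
  ext1 v
  have h1 := M.off_diagonal i j hij
  have key := Module.reflection_mul_reflection_pow_apply (M.simpleCoroot_simpleRoot_self i)
    (M.simpleCoroot_simpleRoot_self j) (M i j) v
  rw [show (M.simpleReflection i * M.simpleReflection j) ^ M i j = _ from rfl]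
  unfold simpleReflection
  rw [key]
  have hfy := M.simpleCoroot_simpleRoot i j
  have hgx := M.simpleCoroot_simpleRoot j i
  rw [M.symmetric j i] at hgx
  rw [hfy, hgx]
  generalize M i j = m at *
  obtain h0 | h2 | h3 : m = 0 ∨ m = 2 ∨ 3 ≤ m := by omega
  · subst h0; simp
  · subst h2; simp
    module
  have hm : (m : ℝ) ≠ 0 := by positivity
  set θ : ℝ := 2 * Real.pi / m with hθ
  have ht : -(2 * Real.cos (Real.pi / m)) * -(2 * Real.cos (Real.pi / m)) - 2
      = 2 * Real.cos θ := by
    rw [hθ, mul_div_assoc, Real.cos_two_mul]; ring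
  have hs : Real.sin θ ≠ 0 := by
    have h3' : (3 : ℝ) ≤ m := by exact_mod_cast h3
    refine (Real.sin_pos_of_pos_of_lt_pi (by positivity) ?_).ne'
    rw [hθ, div_lt_iff₀ (by positivity)]
    nlinarith [Real.pi_pos]
  rw [ht]
  have hS := fun n : ℤ => Polynomial.Chebyshev.S_two_mul_real_cos θ n
  obtain ⟨k, hk⟩ := Nat.even_or_odd' m
  obtain hk | hk := hk
  · have e1 : ((m : ℤ) - 2) / 2 = k - 1 := by omega
    have e2 : ((m : ℤ) - 1) / 2 = k - 1 := by omega
    have hz : (Polynomial.Chebyshev.S ℝ (k - 1)).eval (2 * Real.cos θ) = 0 := by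
      have hk0 : (k : ℝ) ≠ 0 := by
        have : k ≠ 0 := by omega
        exact_mod_cast this
      have := hS (k - 1)
      rw [show ((((k : ℤ) - 1 : ℤ) : ℝ) + 1) * θ = Real.pi by
        rw [hθ]; subst hk; push_cast; field_simp; ring, Real.sin_pi] at this
      exact (mul_eq_zero.1 this).resolve_right hs
    rw [e1, e2, hz]
    simp
  · have e1 : ((m : ℤ) - 2) / 2 = k - 1 := by omega
    have e2 : ((m : ℤ) - 1) / 2 = k := by omega
    have e3 : ((m : ℤ) - 3) / 2 = k - 1 := by omega
    have e4 : (m : ℤ) / 2 = k := by omega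
    have hz : (Polynomial.Chebyshev.S ℝ k).eval (2 * Real.cos θ)
        + (Polynomial.Chebyshev.S ℝ (k - 1)).eval (2 * Real.cos θ) = 0 := by
      have ha := hS k
      have hb := hS (k - 1)
      have hc : Real.sin (((k : ℤ) + 1 : ℝ) * θ) = - Real.sin ((((k : ℤ) - 1 : ℤ) + 1 : ℝ) * θ) := by
        rw [← Real.sin_neg, ← Real.sin_add_two_pi (-_)]
        congr 1
        rw [hθ]; subst hk; push_cast at hm ⊢; field_simp; ring
      rw [hc, ← hb] at ha
      have : ((Polynomial.Chebyshev.S ℝ k).eval (2 * Real.cos θ)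
        + (Polynomial.Chebyshev.S ℝ (k - 1)).eval (2 * Real.cos θ)) * Real.sin θ = 0 := by
        linarith
      exact (mul_eq_zero.1 this).resolve_right hs
    rw [e1, e2, e3, e4, hz]
    simp

end CoxeterMatrix

namespace CoxeterSystem

variable {B : Type*} {M : CoxeterMatrix B} {W : Type*} [Group W] (cs : CoxeterSystem M W)

/-- The action of `W` on `V`, where each generator acts as the corresponding simple reflection. -/
noncomputable def geomRep : W →* ((B →₀ ℝ) ≃ₗ[ℝ] (B →₀ ℝ)) :=
  cs.lift ⟨M.simpleReflection, M.isLiftable_simpleReflection⟩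

theorem geomRep_simple (i : B) : cs.geomRep (cs.simple i) = M.simpleReflection i :=
  cs.lift_apply_simple M.isLiftable_simpleReflection i

/-- The root system `Φ = {w α_i}`. -/
def roots : Set (B →₀ ℝ) :=
  {β | ∃ (w : W) (i : B), β = cs.geomRep w (CoxeterMatrix.simpleRoot i)}

/-- The positive roots `Φ⁺`. -/
def posRoots : Set (B →₀ ℝ) := {β | β ∈ cs.roots ∧ ∀ i, 0 ≤ β i}

/-- The negative roots `Φ⁻`. -/
def negRoots : Set (B →₀ ℝ) := {β | β ∈ cs.roots ∧ ∀ i, β i ≤ 0}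

/-- The inversion set `Φ(w)`. -/
def inversionSet (w : W) : Set (B →₀ ℝ) :=
  {β | β ∈ cs.posRoots ∧ cs.geomRep w⁻¹ β ∈ cs.negRoots}

/-- The set `Φ^R(w)` of right-descent roots. -/
def rightDescentRoots (w : W) : Set (B →₀ ℝ) :=
  {β | ∃ i, cs.IsRightDescent w i ∧ β = -cs.geomRep w (CoxeterMatrix.simpleRoot i)}

/-! ## Weak order, convex sets and gated sets -/

/-- The right weak order: `x` is a prefix of `y`. -/
def IsPrefix (x y : W) : Prop := cs.length y = cs.length x + cs.length (x⁻¹ * y)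

/-- `x` is the unique element of minimal length of `X`. -/
def IsUniqueMinLength (X : Set W) (x : W) : Prop :=
  x ∈ X ∧ ∀ y ∈ X, y ≠ x → cs.length x < cs.length y

/-- `x` is the gate of `X`. -/
def IsGateOf (X : Set W) (x : W) : Prop :=
  cs.IsUniqueMinLength X x ∧ ∀ y ∈ X, cs.IsPrefix x y

/-- `X` is gated. -/
def IsGated (X : Set W) : Prop := ∃ x, cs.IsGateOf X x

/-- `X` is convex: it contains every vertex of every geodesic of the Cayley graph between two of
its elements. -/
def IsConvex (X : Set W) : Prop :=
  ∀ x ∈ X, ∀ y ∈ X, ∀ ω : List B, cs.IsReduced ω → cs.wordProd ω = x⁻¹ * y →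
    ∀ j ≤ ω.length, x * cs.wordProd (ω.take j) ∈ X

/-! ## Cone types, gates, boundary roots and witnesses -/

/-- The cone type `T(w)`. -/
def coneType (w : W) : Set W := {v | cs.length (w * v) = cs.length w + cs.length v}

/-- The cone type part `Q(T)`. -/
def conePart (T : Set W) : Set W := {x | cs.coneType x⁻¹ = T}

/-- The gates `Γ` of the cone type partition, whose parts are the sets `Q(T)` for the cone
types `T`. -/
def gates : Set W := {g | ∃ w : W, cs.IsGateOf (cs.conePart (cs.coneType w)) g}

/-- The tight gates `Γ⁰`. -/
def tightGates : Set W := {g | g ∈ cs.gates ∧ (cs.rightDescentRoots g).ncard = 1}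

/-- The boundary roots `∂T` of a cone type `T`. -/
def boundaryRoots (T : Set W) : Set (B →₀ ℝ) :=
  {β | β ∈ cs.posRoots ∧
    ∃ y : W, ∃ w ∈ cs.conePart T, cs.inversionSet w ∩ cs.inversionSet y = {β}}

/-- The set `∂T(x⁻¹)_β` of witnesses of `β` with respect to `x`. -/
def witnesses (x : W) (β : B →₀ ℝ) : Set W :=
  {y | cs.inversionSet x ∩ cs.inversionSet y = {β}}

end CoxeterSystem

/-! ### The invariant form and nonnegativity of Chebyshev values. -/

namespace CoxeterMatrix

variable {B : Type*} (M : CoxeterMatrix B)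

/-! Everything is read off from inversion sets. Positivity of roots gives `length_inv_mul_add`,
which counts |Φ(x) ∩ Φ(v)| by lengths. Hence the weak order is inclusion of inversion sets
(`isPrefix_iff`), and v lies in T(x⁻¹) exactly when Φ(x) and Φ(v) are disjoint
(`mem_coneType_inv_iff`).

Witness sets are convex because inversion sets along a geodesic lie between the intersection and the
union of those of its ends. A convex set is gated once a local condition on pairs of lower
neighbours holds (`isGated_of_isConvex`); for witnesses it follows from the rank-two statement
`exists_isPrefix_of_isRightDescent`.

A shortest witness y has β as its only right-descent root, since removing any other would leave a
shorter witness. So y is a witness for x, and stays one for every element with the cone type of x: y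
leaves T(x⁻¹) exactly at its last step, which adds β. Moving back and forth between the witnesses of
y and those of a shortest partner shows that y is a gate. -/

theorem rootForm_comm (u v : B →₀ ℝ) : M.rootForm u v = M.rootForm v u := by
  have h : M.rootForm = M.rootForm.flip := by
    ext i j
    have := M.rootForm_simpleRoot i j
    have h' := M.rootForm_simpleRoot j i
    rw [M.symmetric j i] at h'
    simpa [simpleRoot] using this.trans h'.symm
  exact congrArg (fun f => f u v) h

theorem rootForm_simpleRoot_self (i : B) : M.rootForm (simpleRoot i) (simpleRoot i) = 1 := by
  simp [rootForm_simpleRoot]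

theorem rootForm_simpleReflection (i : B) (u v : B →₀ ℝ) :
    M.rootForm (M.simpleReflection i u) (M.simpleReflection i v) = M.rootForm u v := by
  simp only [simpleReflection_apply, map_sub, map_smul, LinearMap.sub_apply, LinearMap.smul_apply,
    smul_eq_mul, rootForm_simpleRoot_self, M.rootForm_comm (simpleRoot i) v]
  ring

theorem simpleReflection_simpleRoot_self (i : B) :
    M.simpleReflection i (simpleRoot i) = -simpleRoot i := by
  rw [simpleReflection_apply, rootForm_simpleRoot_self]
  module

theorem simpleReflection_simpleRoot (i j : B) :
    M.simpleReflection i (simpleRoot j) =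
      simpleRoot j + (2 * Real.cos (Real.pi / (M i j : ℝ))) • simpleRoot i := by
  rw [simpleReflection_apply, rootForm_simpleRoot, M.symmetric j i]
  module

theorem simpleReflection_apply_of_ne {i j : B} (h : j ≠ i) (v : B →₀ ℝ) :
    M.simpleReflection i v j = v j := by
  simp [simpleReflection_apply, simpleRoot, Finsupp.single_eq_of_ne h]

theorem simpleRoot_nonneg (i : B) : 0 ≤ simpleRoot i :=
  Finsupp.single_nonneg.2 zero_le_one

theorem simpleRoot_ne_zero (i : B) : simpleRoot i ≠ 0 :=
  Finsupp.single_ne_zero.2 one_ne_zero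

/-- With θ = π/m, U_k(cos θ) sin θ = sin((k+1)θ), and (k+1)θ ≤ π. For m = 0 (infinite label) the
value is U_k(1) = k + 1. -/
theorem chebyshev_U_eval_cos_nonneg {m k : ℕ} (hm : m ≠ 1) (hk : m = 0 ∨ k + 1 ≤ m) :
    0 ≤ (Polynomial.Chebyshev.U ℝ k).eval (Real.cos (Real.pi / m)) := by
  obtain rfl | hk := hk
  · simp only [Nat.cast_zero, div_zero, Real.cos_zero, Polynomial.Chebyshev.U_eval_one]
    positivity
  have h2 : (2 : ℝ) ≤ m := by exact_mod_cast (by omega : 2 ≤ m)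
  have hk' : (k : ℝ) + 1 ≤ m := by exact_mod_cast hk
  have hsin : 0 < Real.sin (Real.pi / m) := by
    refine Real.sin_pos_of_pos_of_lt_pi (by positivity) ?_
    rw [div_lt_iff₀ (by positivity)]
    nlinarith [Real.pi_pos]
  have h := Polynomial.Chebyshev.U_real_cos (Real.pi / m) k
  have h' : 0 ≤ Real.sin (((k : ℤ) + 1) * (Real.pi / m)) := by
    refine Real.sin_nonneg_of_nonneg_of_le_pi (by push_cast; positivity) ?_
    rw [← mul_div_assoc, div_le_iff₀ (by positivity)]
    push_cast
    nlinarith [Real.pi_pos]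
  rw [← h] at h'
  exact nonneg_of_mul_nonneg_left h' hsin

end CoxeterMatrix

/-! ### Positivity of roots via rank-two words. -/

namespace CoxeterSystem

open CoxeterMatrix List

variable {B : Type*} {M : CoxeterMatrix B} {W : Type*} [Group W] (cs : CoxeterSystem M W)

theorem geomRep_mul_apply (u v : W) (x : B →₀ ℝ) :
    cs.geomRep (u * v) x = cs.geomRep u (cs.geomRep v x) := by
  rw [map_mul]; rfl

@[simp]
theorem geomRep_inv_apply_self (u : W) (x : B →₀ ℝ) :
    cs.geomRep u⁻¹ (cs.geomRep u x) = x := by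
  rw [← geomRep_mul_apply]; simp

@[simp]
theorem geomRep_apply_inv_self (u : W) (x : B →₀ ℝ) :
    cs.geomRep u (cs.geomRep u⁻¹ x) = x := by
  rw [← geomRep_mul_apply]; simp

theorem geomRep_mul_simple_simpleRoot (w : W) (i : B) :
    cs.geomRep (w * cs.simple i) (simpleRoot i) = -cs.geomRep w (simpleRoot i) := by
  rw [geomRep_mul_apply, geomRep_simple, simpleReflection_simpleRoot_self, map_neg]

theorem rootForm_geomRep (w : W) (u v : B →₀ ℝ) :
    M.rootForm (cs.geomRep w u) (cs.geomRep w v) = M.rootForm u v := by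
  induction w using cs.simple_induction_left with
  | one => simp
  | mul_simple_left w i ih =>
    rw [geomRep_mul_apply, geomRep_mul_apply, geomRep_simple, rootForm_simpleReflection, ih]

/-- A word in the letters `i`, `j` that remains reduced after appending `i` is alternating. -/
theorem eq_alternatingWord_of_isReduced_concat {i j : B} (ω : List B)
    (hω : ∀ k ∈ ω, k = i ∨ k = j) (h : cs.IsReduced (ω ++ [i])) :
    ω = alternatingWord i j ω.length := by
  induction ω using List.reverseRecOn generalizing i j with
  | nil => rfl
  | append_singleton ω k ih =>
    have hk : k = j := by
      refine (hω k (by simp)).resolve_left ?_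
      rintro rfl
      have h1 := h.eq
      have h2 := cs.length_wordProd_le ω
      simp [wordProd_append, wordProd_cons] at h1
      omega
    subst hk
    have h' : cs.IsReduced (ω ++ [k]) := by
      have := h.take (ω ++ [k]).length
      rwa [List.take_left] at this
    have e := ih (i := k) (j := i) (fun l hl => (hω l (by simp [hl])).symm) h'
    rw [length_append, length_singleton, alternatingWord_succ, ← e, concat_eq_append]

/-- Each further letter reflects the coefficient pair, which is the recursion U_{k+1} = 2 cos(π/m)
U_k - U_{k-1}, starting from U_{-1} = 0. -/
theorem geomRep_alternatingWord_simpleRoot (i j : B) (k : ℕ) :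
    cs.geomRep (cs.wordProd (alternatingWord i j k)) (simpleRoot i) =
      (Polynomial.Chebyshev.U ℝ k).eval (Real.cos (Real.pi / M i j)) •
          simpleRoot (if Even k then i else j) +
        (Polynomial.Chebyshev.U ℝ (k - 1)).eval (Real.cos (Real.pi / M i j)) •
          simpleRoot (if Even k then j else i) := by
  induction k with
  | zero => simp [alternatingWord]
  | succ k ih =>
    rw [alternatingWord_succ', wordProd_cons, geomRep_mul_apply, ih, geomRep_simple]
    have hU := Polynomial.Chebyshev.U_eq ℝ ((k : ℤ) + 1)
    rw [show ((k : ℤ) + 1) - 1 = k by ring, show ((k : ℤ) + 1) - 2 = k - 1 by ring] at hU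
    push_cast
    rw [hU]
    by_cases hk : Even k <;>
    · simp only [hk, Nat.even_add_one, not_true, not_false_iff, if_true, if_false, map_add,
        map_smul, simpleReflection_simpleRoot_self, simpleReflection_simpleRoot, M.symmetric j i,
        add_sub_cancel_right]
      simp only [Polynomial.eval_sub, Polynomial.eval_mul, Polynomial.eval_X, Polynomial.eval_ofNat]
      module

theorem exists_nonneg_geomRep_wordProd_simpleRoot {i j : B} (hij : i ≠ j) (ω : List B)
    (hω : ∀ k ∈ ω, k = i ∨ k = j) (h : cs.IsReduced (ω ++ [i])) :
    ∃ a b : ℝ, 0 ≤ a ∧ 0 ≤ b ∧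
      cs.geomRep (cs.wordProd ω) (simpleRoot i) = a • simpleRoot i + b • simpleRoot j := by
  have e := cs.eq_alternatingWord_of_isReduced_concat ω hω h
  set k := ω.length
  -- A reduced alternating word has length at most m(i, j), exactly the range where the Chebyshev
  -- values are nonnegative.
  have hm : M i j = 0 ∨ k + 1 ≤ M i j := by
    by_contra! hcon
    refine cs.not_isReduced_alternatingWord j i (m := k + 1) ?_ ?_ ?_
    · rw [M.symmetric]; exact hcon.1
    · rw [M.symmetric]; exact hcon.2
    · rw [alternatingWord_succ, ← e, concat_eq_append]; exact h
  have h1 : M i j ≠ 1 := M.off_diagonal i j hij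
  have ha := chebyshev_U_eval_cos_nonneg h1 hm
  have hb : 0 ≤ (Polynomial.Chebyshev.U ℝ ((k : ℤ) - 1)).eval (Real.cos (Real.pi / M i j)) := by
    rcases k with _ | k
    · simp
    · have := chebyshev_U_eval_cos_nonneg (k := k) h1 (by omega)
      simpa using this
  rw [e, geomRep_alternatingWord_simpleRoot]
  split_ifs
  · exact ⟨_, _, ha, hb, rfl⟩
  · exact ⟨_, _, hb, ha, add_comm _ _⟩

/-- Split w = v·u with u a word in i and a descent j. The rank-two case makes u α_i a nonnegative
combination of α_i and α_j, and induction applies to the shorter v, which has neither descent. -/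
theorem geomRep_simpleRoot_nonneg {w : W} {i : B} (h : ¬ cs.IsRightDescent w i) :
    0 ≤ cs.geomRep w (simpleRoot i) := by
  induction hn : cs.length w using Nat.strong_induction_on generalizing w i with
  | _ n ih =>
  subst hn
  obtain rfl | hw := eq_or_ne w 1
  · simpa using simpleRoot_nonneg i
  obtain ⟨j, hj⟩ := cs.exists_rightDescent_of_ne_one hw
  have hij : i ≠ j := by rintro rfl; exact h hj
  -- `v` is a shortest left factor of `w` whose complement is a word in `i`, `j`
  let A : Set W := {v | ∃ ω : List B, (∀ k ∈ ω, k = i ∨ k = j) ∧ w = v * cs.wordProd ω ∧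
    cs.length w = cs.length v + ω.length}
  have hwj : w * cs.simple j ∈ A :=
    ⟨[j], by simp, by simp, by simpa using (cs.isRightDescent_iff.1 hj).symm⟩
  obtain ⟨v, ⟨ω, hω, hv, hlen⟩, hmin⟩ :=
    (measure cs.length).wf.has_min A ⟨_, hwj⟩
  have hmin' : ∀ u ∈ A, cs.length v ≤ cs.length u := fun u hu => not_lt.1 (hmin u hu)
  have hlt : cs.length v < cs.length w := (hmin' _ hwj).trans_lt hj
  have hdesc : ∀ k, k = i ∨ k = j → ¬ cs.IsRightDescent v k := by
    intro k hk hvk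
    have hvk' := cs.isRightDescent_iff.1 hvk
    have : v * cs.simple k ∈ A := by
      refine ⟨k :: ω, ?_, ?_, ?_⟩
      · rintro l (_ | ⟨_, hl⟩)
        · exact hk
        · exact hω l hl
      · simp [wordProd_cons, hv, mul_assoc]
      · simp only [List.length_cons]; omega
    have := hmin' _ this
    omega
  have hred : cs.IsReduced (ω ++ [i]) := by
    refine le_antisymm (cs.length_wordProd_le _) ?_
    have h1 := cs.not_isRightDescent_iff.1 h
    have h2 := cs.length_mul_le v (cs.wordProd (ω ++ [i]))
    rw [wordProd_append, wordProd_singleton, ← mul_assoc, ← hv, ← wordProd_singleton,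
      ← wordProd_append, wordProd_singleton] at h2
    simp only [List.length_append, List.length_singleton]
    omega
  obtain ⟨a, b, ha, hb, e⟩ := cs.exists_nonneg_geomRep_wordProd_simpleRoot hij ω hω hred
  rw [hv, geomRep_mul_apply, e, map_add, map_smul, map_smul]
  exact add_nonneg (smul_nonneg ha (ih _ hlt (hdesc i (.inl rfl)) rfl))
    (smul_nonneg hb (ih _ hlt (hdesc j (.inr rfl)) rfl))

theorem geomRep_simpleRoot_nonpos {w : W} {i : B} (h : cs.IsRightDescent w i) :
    cs.geomRep w (simpleRoot i) ≤ 0 := by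
  have := cs.geomRep_simpleRoot_nonneg (cs.isRightDescent_iff_not_isRightDescent_mul.1 h)
  rwa [geomRep_mul_simple_simpleRoot, neg_nonneg] at this

/-! ### Positive and negative roots -/

theorem geomRep_mem_roots {γ : B →₀ ℝ} (h : γ ∈ cs.roots) (w : W) :
    cs.geomRep w γ ∈ cs.roots := by
  obtain ⟨u, i, rfl⟩ := h
  exact ⟨w * u, i, (cs.geomRep_mul_apply _ _ _).symm⟩

theorem neg_mem_roots {γ : B →₀ ℝ} (h : γ ∈ cs.roots) : -γ ∈ cs.roots := by
  obtain ⟨u, i, rfl⟩ := h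
  exact ⟨u * cs.simple i, i, (cs.geomRep_mul_simple_simpleRoot u i).symm⟩

theorem ne_zero_of_mem_roots {γ : B →₀ ℝ} (h : γ ∈ cs.roots) : γ ≠ 0 := by
  obtain ⟨u, i, rfl⟩ := h
  exact (LinearEquiv.map_ne_zero_iff _).2 (simpleRoot_ne_zero i)

theorem rootForm_self_of_mem_roots {γ : B →₀ ℝ} (h : γ ∈ cs.roots) : M.rootForm γ γ = 1 := by
  obtain ⟨u, i, rfl⟩ := h
  rw [rootForm_geomRep, rootForm_simpleRoot_self]

theorem mem_posRoots_iff {γ : B →₀ ℝ} : γ ∈ cs.posRoots ↔ γ ∈ cs.roots ∧ 0 ≤ γ := Iff.rfl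

theorem mem_negRoots_iff {γ : B →₀ ℝ} : γ ∈ cs.negRoots ↔ γ ∈ cs.roots ∧ γ ≤ 0 := Iff.rfl

theorem mem_posRoots_or_mem_negRoots {γ : B →₀ ℝ} (h : γ ∈ cs.roots) :
    γ ∈ cs.posRoots ∨ γ ∈ cs.negRoots := by
  rw [mem_posRoots_iff, mem_negRoots_iff]
  obtain ⟨u, i, rfl⟩ := id h
  by_cases hd : cs.IsRightDescent u i
  · exact .inr ⟨h, cs.geomRep_simpleRoot_nonpos hd⟩
  · exact .inl ⟨h, cs.geomRep_simpleRoot_nonneg hd⟩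

theorem not_mem_negRoots_of_mem_posRoots {γ : B →₀ ℝ} (h : γ ∈ cs.posRoots) :
    γ ∉ cs.negRoots := fun h' =>
  cs.ne_zero_of_mem_roots h.1 (le_antisymm (cs.mem_negRoots_iff.1 h').2 (cs.mem_posRoots_iff.1 h).2)

theorem neg_mem_negRoots_iff {γ : B →₀ ℝ} : -γ ∈ cs.negRoots ↔ γ ∈ cs.posRoots := by
  rw [mem_negRoots_iff, mem_posRoots_iff, neg_nonpos]
  exact and_congr_left fun _ => ⟨fun h => by simpa using cs.neg_mem_roots h, cs.neg_mem_roots⟩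

theorem neg_mem_posRoots_iff {γ : B →₀ ℝ} : -γ ∈ cs.posRoots ↔ γ ∈ cs.negRoots := by
  rw [← neg_mem_negRoots_iff, neg_neg]

theorem not_mem_posRoots_iff {γ : B →₀ ℝ} (h : γ ∈ cs.roots) :
    γ ∉ cs.posRoots ↔ γ ∈ cs.negRoots :=
  ⟨(cs.mem_posRoots_or_mem_negRoots h).resolve_left,
    fun h' h'' => cs.not_mem_negRoots_of_mem_posRoots h'' h'⟩

theorem not_mem_negRoots_iff {γ : B →₀ ℝ} (h : γ ∈ cs.roots) :
    γ ∉ cs.negRoots ↔ γ ∈ cs.posRoots :=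
  ⟨(cs.mem_posRoots_or_mem_negRoots h).resolve_right, cs.not_mem_negRoots_of_mem_posRoots⟩

theorem geomRep_simpleRoot_mem_posRoots_iff {w : W} {i : B} :
    cs.geomRep w (simpleRoot i) ∈ cs.posRoots ↔ ¬ cs.IsRightDescent w i := by
  refine ⟨fun h hd => ?_, fun h => ⟨⟨w, i, rfl⟩, cs.geomRep_simpleRoot_nonneg h⟩⟩
  exact cs.not_mem_negRoots_of_mem_posRoots h ⟨⟨w, i, rfl⟩, cs.geomRep_simpleRoot_nonpos hd⟩

theorem simpleRoot_mem_posRoots (i : B) : simpleRoot i ∈ cs.posRoots := by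
  simpa using cs.geomRep_simpleRoot_mem_posRoots_iff.2 (cs.not_isRightDescent_one i)

/-- A simple reflection permutes the positive roots other than its own simple root. -/
theorem geomRep_simple_mem_posRoots {γ : B →₀ ℝ} {i : B} (h : γ ∈ cs.posRoots)
    (hi : γ ≠ simpleRoot i) : cs.geomRep (cs.simple i) γ ∈ cs.posRoots := by
  have hr := cs.geomRep_mem_roots h.1 (cs.simple i)
  by_contra hcon
  rw [not_mem_posRoots_iff _ hr] at hcon
  -- The reflection changes only the coordinate at i, so a sign change forces γ onto the line of
  -- α_i; norm 1 then gives γ = α_i.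
  have hz : ∀ j, j ≠ i → γ j = 0 := fun j hj => by
    have h1 := hcon.2 j
    rw [geomRep_simple, simpleReflection_apply_of_ne _ hj] at h1
    exact le_antisymm h1 (h.2 j)
  have hγ : γ = γ i • simpleRoot i := by
    ext j
    obtain rfl | hj := eq_or_ne j i
    · simp [simpleRoot]
    · simp [simpleRoot, hz j hj, Finsupp.single_eq_of_ne hj]
  have hn := cs.rootForm_self_of_mem_roots h.1
  rw [hγ] at hn
  simp only [map_smul, LinearMap.smul_apply, rootForm_simpleRoot_self, smul_eq_mul, mul_one] at hn
  have h1 : γ i = 1 := by nlinarith [h.2 i]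
  rw [h1, one_smul] at hγ
  exact hi hγ

/-! ### Inversion sets -/

theorem mem_inversionSet_iff {w : W} {γ : B →₀ ℝ} :
    γ ∈ cs.inversionSet w ↔ γ ∈ cs.posRoots ∧ cs.geomRep w⁻¹ γ ∈ cs.negRoots := Iff.rfl

theorem not_mem_inversionSet_iff {w : W} {γ : B →₀ ℝ} (h : γ ∈ cs.posRoots) :
    γ ∉ cs.inversionSet w ↔ cs.geomRep w⁻¹ γ ∈ cs.posRoots := by
  rw [mem_inversionSet_iff, ← cs.not_mem_negRoots_iff (cs.geomRep_mem_roots h.1 _)]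
  tauto

theorem inversionSet_one : cs.inversionSet 1 = ∅ := by
  ext γ
  simp only [mem_inversionSet_iff, inv_one, map_one, LinearEquiv.coe_one, id_eq,
    Set.mem_empty_iff_false, iff_false, not_and]
  exact cs.not_mem_negRoots_of_mem_posRoots

theorem geomRep_simpleRoot_notMem_inversionSet (w : W) (i : B) :
    cs.geomRep w (simpleRoot i) ∉ cs.inversionSet w := fun h => by
  have := h.2
  rw [geomRep_inv_apply_self] at this
  exact cs.not_mem_negRoots_of_mem_posRoots (cs.simpleRoot_mem_posRoots i) this

theorem inversionSet_mul_simple {w : W} {i : B} (h : ¬ cs.IsRightDescent w i) :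
    cs.inversionSet (w * cs.simple i) =
      insert (cs.geomRep w (simpleRoot i)) (cs.inversionSet w) := by
  have hp := cs.geomRep_simpleRoot_mem_posRoots_iff.2 h
  ext γ
  rw [Set.mem_insert_iff]
  by_cases hγ : γ ∈ cs.posRoots
  swap
  · simp only [mem_inversionSet_iff, hγ, false_and, or_false, false_iff]
    rintro rfl
    exact hγ hp
  obtain rfl | hne := eq_or_ne γ (cs.geomRep w (simpleRoot i))
  · simp only [true_or, iff_true, mem_inversionSet_iff, hγ, true_and, mul_inv_rev,
      geomRep_mul_apply, geomRep_inv_apply_self, inv_simple, geomRep_simple,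
      simpleReflection_simpleRoot_self, neg_mem_negRoots_iff]
    exact cs.simpleRoot_mem_posRoots i
  simp only [hne, false_or, mem_inversionSet_iff, hγ, true_and, mul_inv_rev, inv_simple,
    geomRep_mul_apply]
  obtain h' | h' := cs.mem_posRoots_or_mem_negRoots (cs.geomRep_mem_roots hγ.1 w⁻¹)
  · have := cs.geomRep_simple_mem_posRoots (i := i) h' fun e => hne (by simp [← e])
    exact iff_of_false (cs.not_mem_negRoots_of_mem_posRoots this)
      (cs.not_mem_negRoots_of_mem_posRoots h')
  · refine iff_of_true ?_ h'
    have := cs.geomRep_simple_mem_posRoots (i := i) (cs.neg_mem_posRoots_iff.2 h') fun e => by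
      have e' : γ = -cs.geomRep w (simpleRoot i) := by simp [← e]
      rw [e'] at hγ
      exact cs.not_mem_negRoots_of_mem_posRoots hp (cs.neg_mem_posRoots_iff.1 hγ)
    rwa [map_neg, neg_mem_posRoots_iff] at this

theorem inversionSet_mul_simple_of_isRightDescent {w : W} {i : B} (h : cs.IsRightDescent w i) :
    cs.inversionSet (w * cs.simple i) =
      cs.inversionSet w \ {-cs.geomRep w (simpleRoot i)} := by
  have h' := cs.isRightDescent_iff_not_isRightDescent_mul.1 h
  have e := cs.inversionSet_mul_simple h'
  rw [simple_mul_simple_cancel_right, geomRep_mul_simple_simpleRoot] at e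
  rw [e, Set.insert_sdiff_self_of_notMem]
  rw [← geomRep_mul_simple_simpleRoot]
  exact cs.geomRep_simpleRoot_notMem_inversionSet _ _

theorem neg_geomRep_simpleRoot_mem_inversionSet {w : W} {i : B} (h : cs.IsRightDescent w i) :
    -cs.geomRep w (simpleRoot i) ∈ cs.inversionSet w := by
  have h' := cs.isRightDescent_iff_not_isRightDescent_mul.1 h
  have e := cs.inversionSet_mul_simple h'
  rw [simple_mul_simple_cancel_right, geomRep_mul_simple_simpleRoot] at e
  rw [e]
  exact Set.mem_insert _ _

theorem induction_on_length {p : W → Prop} (w : W) (one : p 1)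
    (mul : ∀ w i, ¬ cs.IsRightDescent w i → p w → p (w * cs.simple i)) : p w := by
  induction hn : cs.length w using Nat.strong_induction_on generalizing w with
  | _ n ih =>
  subst hn
  obtain rfl | hw := eq_or_ne w 1
  · exact one
  obtain ⟨i, hi⟩ := cs.exists_rightDescent_of_ne_one hw
  have := mul _ i (cs.isRightDescent_iff_not_isRightDescent_mul.1 hi) (ih _ hi _ rfl)
  rwa [simple_mul_simple_cancel_right] at this

theorem finite_inversionSet (w : W) : (cs.inversionSet w).Finite := by
  induction w using cs.induction_on_length with
  | one => simp [inversionSet_one]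
  | mul w i h ih => rw [cs.inversionSet_mul_simple h]; exact ih.insert _

/-- Lengthening v by a simple reflection adds one root to Φ(v). That root lies in Φ(x) exactly when
x⁻¹v gets shorter, so both sides change by the same amount. -/
theorem length_inv_mul_add (x v : W) :
    cs.length (x⁻¹ * v) + 2 * (cs.inversionSet x ∩ cs.inversionSet v).ncard =
      cs.length x + cs.length v := by
  induction v using cs.induction_on_length with
  | one => simp [inversionSet_one]
  | mul v i h ih =>
    have hv := cs.not_isRightDescent_iff.1 h
    have hp := cs.geomRep_simpleRoot_mem_posRoots_iff.2 h
    rw [cs.inversionSet_mul_simple h, ← mul_assoc]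
    by_cases hx : cs.geomRep v (simpleRoot i) ∈ cs.inversionSet x
    · rw [Set.inter_insert_of_mem hx, Set.ncard_insert_of_notMem
        (fun h' => cs.geomRep_simpleRoot_notMem_inversionSet v i h'.2)
        ((cs.finite_inversionSet x).inter_of_left _)]
      have hd : cs.IsRightDescent (x⁻¹ * v) i := by
        by_contra hd
        rw [← geomRep_simpleRoot_mem_posRoots_iff, geomRep_mul_apply] at hd
        exact cs.not_mem_negRoots_of_mem_posRoots hd hx.2
      have := cs.isRightDescent_iff.1 hd
      omega
    · rw [Set.inter_insert_of_notMem hx]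
      rw [cs.not_mem_inversionSet_iff hp, ← geomRep_mul_apply,
        geomRep_simpleRoot_mem_posRoots_iff] at hx
      have := cs.not_isRightDescent_iff.1 hx
      omega

theorem ncard_inversionSet (w : W) : (cs.inversionSet w).ncard = cs.length w := by
  have := cs.length_inv_mul_add w w
  simp only [inv_mul_cancel, length_one, Set.inter_self] at this
  omega

theorem isPrefix_iff {x y : W} : cs.IsPrefix x y ↔ cs.inversionSet x ⊆ cs.inversionSet y := by
  have h := cs.length_inv_mul_add x y
  have hx := cs.ncard_inversionSet x
  have : cs.IsPrefix x y ↔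
      (cs.inversionSet x ∩ cs.inversionSet y).ncard = (cs.inversionSet x).ncard := by
    unfold IsPrefix; omega
  rw [this, ← Set.inter_eq_left]
  exact ⟨fun h => Set.eq_of_subset_of_ncard_le Set.inter_subset_left h.ge
    (cs.finite_inversionSet x), fun h => by rw [h]⟩

theorem mem_coneType_inv_iff {x v : W} :
    v ∈ cs.coneType x⁻¹ ↔ cs.inversionSet x ∩ cs.inversionSet v = ∅ := by
  have h := cs.length_inv_mul_add x v
  rw [← Set.ncard_eq_zero ((cs.finite_inversionSet x).inter_of_left _)]
  simp only [coneType, Set.mem_ofPred_eq, length_inv]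
  omega

theorem IsPrefix.refl (x : W) : cs.IsPrefix x x := cs.isPrefix_iff.2 subset_rfl

variable {cs} in
theorem IsPrefix.trans {x y z : W} (h : cs.IsPrefix x y) (h' : cs.IsPrefix y z) :
    cs.IsPrefix x z :=
  cs.isPrefix_iff.2 ((cs.isPrefix_iff.1 h).trans (cs.isPrefix_iff.1 h'))

variable {cs} in
theorem IsPrefix.eq_of_length_le {x y : W} (h : cs.IsPrefix x y)
    (h' : cs.length y ≤ cs.length x) : x = y := by
  have : cs.length (x⁻¹ * y) = 0 := by unfold IsPrefix at h; omega
  exact inv_mul_eq_one.1 (cs.length_eq_zero_iff.1 this)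

/-! ### Geodesics and rank-two cosets. -/

/-- The inversion set of an element of a geodesic lies between the intersection and the union of
the inversion sets of the end points. -/
theorem inversionSet_of_length_add {y a b : W}
    (h : cs.length (a * b) = cs.length a + cs.length b) :
    cs.inversionSet y ∩ cs.inversionSet (y * (a * b)) ⊆ cs.inversionSet (y * a) ∧
      cs.inversionSet (y * a) ⊆ cs.inversionSet y ∪ cs.inversionSet (y * (a * b)) := by
  have hab : cs.inversionSet a ⊆ cs.inversionSet (a * b) :=
    cs.isPrefix_iff.1 (by simpa [IsPrefix] using h)
  constructor
  · rintro γ ⟨hy, hz⟩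
    by_contra hu
    rw [cs.not_mem_inversionSet_iff hy.1, mul_inv_rev, geomRep_mul_apply] at hu
    have h1 : -cs.geomRep y⁻¹ γ ∈ cs.inversionSet a :=
      ⟨cs.neg_mem_posRoots_iff.2 hy.2, by rwa [map_neg, neg_mem_negRoots_iff]⟩
    have h2 := (hab h1).2
    have h3 := hz.2
    rw [mul_inv_rev, geomRep_mul_apply] at h3
    rw [map_neg, neg_mem_negRoots_iff] at h2
    exact cs.not_mem_negRoots_of_mem_posRoots h2 h3
  · intro γ hu
    by_contra hcon
    rw [Set.mem_union, not_or, cs.not_mem_inversionSet_iff hu.1,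
      cs.not_mem_inversionSet_iff hu.1] at hcon
    have hu2 := hu.2
    rw [mul_inv_rev, geomRep_mul_apply] at hu2 hcon
    exact cs.not_mem_negRoots_of_mem_posRoots hcon.2 (hab ⟨hcon.1, hu2⟩).2

/-- Any two lower neighbours of `p` have a common prefix `m` such that every inversion of `p`
that is not one of `m` is a nonnegative combination of the two corresponding descent roots. -/
theorem exists_isPrefix_of_isRightDescent {p : W} {i j : B} (hi : cs.IsRightDescent p i)
    (hj : cs.IsRightDescent p j) :
    ∃ m, cs.IsPrefix m (p * cs.simple i) ∧ cs.IsPrefix m (p * cs.simple j) ∧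
      ∀ γ ∈ cs.inversionSet p, γ ∉ cs.inversionSet m → ∃ a b : ℝ, 0 ≤ a ∧ 0 ≤ b ∧
        γ = a • -cs.geomRep p (simpleRoot i) + b • -cs.geomRep p (simpleRoot j) := by
  let H : Subgroup W := Subgroup.closure {cs.simple i, cs.simple j}
  have hiH : cs.simple i ∈ H := Subgroup.subset_closure (by simp)
  have hjH : cs.simple j ∈ H := Subgroup.subset_closure (by simp)
  -- elements of `H` only change the coordinates at `i` and `j`
  have hcoord : ∀ v ∈ H, ∀ γ : B →₀ ℝ, ∀ k, k ≠ i → k ≠ j → cs.geomRep v γ k = γ k := by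
    intro v hv
    induction hv using Subgroup.closure_induction with
    | mem x hx =>
      intro γ k hki hkj
      obtain rfl | rfl := hx
      · rw [geomRep_simple, simpleReflection_apply_of_ne _ hki]
      · rw [geomRep_simple, simpleReflection_apply_of_ne _ hkj]
    | one => simp
    | mul x y _ _ hx hy =>
      intro γ k hki hkj
      rw [geomRep_mul_apply, hx _ k hki hkj, hy _ k hki hkj]
    | inv x _ hx =>
      intro γ k hki hkj
      rw [← hx (cs.geomRep x⁻¹ γ) k hki hkj, geomRep_apply_inv_self]
  have hspan : ∀ γ : B →₀ ℝ, 0 ≤ γ → (∀ k, k ≠ i → k ≠ j → γ k = 0) → ∃ a b : ℝ, 0 ≤ a ∧ 0 ≤ b ∧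
      γ = a • simpleRoot i + b • simpleRoot j := by
    intro γ h0 hz
    obtain rfl | hij := eq_or_ne i j
    · refine ⟨γ i, 0, h0 i, le_rfl, ?_⟩
      ext k
      obtain rfl | hki := eq_or_ne k i
      · simp [simpleRoot]
      · simp [simpleRoot, hz k hki hki, Finsupp.single_eq_of_ne hki]
    refine ⟨γ i, γ j, h0 i, h0 j, ?_⟩
    ext k
    obtain rfl | hki := eq_or_ne k i
    · simp [simpleRoot, Finsupp.single_eq_of_ne hij]
    obtain rfl | hkj := eq_or_ne k j
    · simp [simpleRoot, Finsupp.single_eq_of_ne hki]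
    · simp [simpleRoot, hz k hki hkj, Finsupp.single_eq_of_ne hki, Finsupp.single_eq_of_ne hkj]
  -- a shortest element of the coset `p H`
  obtain ⟨m, hmH, hmin⟩ := (measure cs.length).wf.has_min {m : W | p⁻¹ * m ∈ H} ⟨p, by simp⟩
  have hmi : ¬ cs.IsRightDescent m i :=
    hmin (m * cs.simple i) (by simpa [← mul_assoc] using H.mul_mem hmH hiH)
  have hmj : ¬ cs.IsRightDescent m j :=
    hmin (m * cs.simple j) (by simpa [← mul_assoc] using H.mul_mem hmH hjH)
  have hmpos : ∀ γ : B →₀ ℝ, 0 ≤ γ → (∀ k, k ≠ i → k ≠ j → γ k = 0) → 0 ≤ cs.geomRep m γ := by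
    intro γ h0 hz
    obtain ⟨a, b, ha, hb, rfl⟩ := hspan γ h0 hz
    rw [map_add, map_smul, map_smul]
    exact add_nonneg (smul_nonneg ha (cs.geomRep_simpleRoot_nonneg hmi))
      (smul_nonneg hb (cs.geomRep_simpleRoot_nonneg hmj))
  have hpm : ∀ γ k, k ≠ i → k ≠ j → cs.geomRep p⁻¹ γ k = cs.geomRep m⁻¹ γ k := by
    intro γ k hki hkj
    rw [← hcoord _ hmH (cs.geomRep m⁻¹ γ) k hki hkj, ← geomRep_mul_apply]
    simp
  -- Since m sends nonnegative combinations of α_i and α_j to nonnegative vectors, an inversion γ of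
  -- m cannot have m⁻¹γ supported on {i, j}.
  have hsupp : ∀ γ ∈ cs.posRoots, cs.geomRep m⁻¹ γ ∈ cs.negRoots →
      ∃ k, k ≠ i ∧ k ≠ j ∧ cs.geomRep m⁻¹ γ k ≠ 0 := by
    intro γ hγ hm
    by_contra! hcon
    have := hmpos (-cs.geomRep m⁻¹ γ) (by simpa using (cs.mem_negRoots_iff.1 hm).2)
      (fun k hki hkj => by simpa using hcon k hki hkj)
    rw [map_neg, geomRep_apply_inv_self] at this
    exact cs.not_mem_negRoots_of_mem_posRoots hγ ⟨hγ.1, neg_nonneg.1 this⟩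
  -- The vectors p⁻¹γ and m⁻¹γ agree off {i, j}, so a negative coordinate there decides the sign of
  -- both.
  have hsub : cs.inversionSet m ⊆ cs.inversionSet p := by
    intro γ hγ
    by_contra hcon
    rw [cs.not_mem_inversionSet_iff hγ.1] at hcon
    obtain ⟨k, hki, hkj, hk⟩ := hsupp γ hγ.1 hγ.2
    refine hk (le_antisymm (hγ.2.2 k) ?_)
    rw [← hpm γ k hki hkj]
    exact hcon.2 k
  have hroot : ∀ k, k = i ∨ k = j → -cs.geomRep p (simpleRoot k) ∉ cs.inversionSet m := by
    intro l hl hmem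
    obtain ⟨k, hki, hkj, hk⟩ := hsupp _ hmem.1 hmem.2
    rw [← hpm _ k hki hkj] at hk
    refine hk ?_
    have : k ≠ l := by rintro rfl; tauto
    simp [simpleRoot, Finsupp.single_eq_of_ne this]
  have hpre : ∀ k, k = i ∨ k = j → cs.IsRightDescent p k → cs.IsPrefix m (p * cs.simple k) := by
    intro k hk hd
    rw [isPrefix_iff, cs.inversionSet_mul_simple_of_isRightDescent hd]
    exact Set.subset_sdiff_singleton hsub (hroot k hk)
  refine ⟨m, hpre i (.inl rfl) hi, hpre j (.inr rfl) hj, fun γ hγ hm => ?_⟩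
  rw [cs.not_mem_inversionSet_iff hγ.1] at hm
  -- Off {i, j} the common coordinates of p⁻¹γ ≤ 0 and m⁻¹γ ≥ 0 must vanish.
  obtain ⟨a, b, ha, hb, e⟩ := hspan (-cs.geomRep p⁻¹ γ)
    (by simpa using (cs.mem_negRoots_iff.1 hγ.2).2) fun k hki hkj => by
      have h1 := hγ.2.2 k
      have h2 := hm.2 k
      have h3 := hpm γ k hki hkj
      simp only [Finsupp.coe_neg, Pi.neg_apply]
      linarith
  refine ⟨a, b, ha, hb, ?_⟩
  have := congrArg (cs.geomRep p) e
  rw [map_neg, geomRep_apply_inv_self, map_add, map_smul, map_smul] at this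
  rw [smul_neg, smul_neg, ← neg_add, ← this, neg_neg]

/-! ### Convex and gated sets -/

variable {cs} in
theorem IsConvex.mul_mem {X : Set W} (hX : cs.IsConvex X) {y a b : W} (hy : y ∈ X)
    (hz : y * (a * b) ∈ X) (h : cs.length (a * b) = cs.length a + cs.length b) : y * a ∈ X := by
  obtain ⟨ω, hω, rfl⟩ := cs.exists_isReduced a
  obtain ⟨ω', hω', rfl⟩ := cs.exists_isReduced b
  have hred : cs.IsReduced (ω ++ ω') := by
    rw [IsReduced, wordProd_append, h, hω.eq, hω'.eq, List.length_append]
  simpa using hX y hy _ hz (ω ++ ω') hred (by simp [wordProd_append]) ω.length (by simp)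

/-- A proper prefix `g` of `p` is a prefix of a lower neighbour of `p`. -/
theorem exists_isPrefix_mul_simple {g p : W} (h : cs.IsPrefix g p) (hne : g ≠ p) :
    ∃ i, cs.IsRightDescent p i ∧ cs.IsPrefix g (p * cs.simple i) := by
  have hne' : g⁻¹ * p ≠ 1 := fun e => hne (inv_mul_eq_one.1 e)
  obtain ⟨i, hi⟩ := cs.exists_rightDescent_of_ne_one hne'
  have hi' := cs.isRightDescent_iff.1 hi
  have h1 := cs.length_mul_le g (g⁻¹ * p * cs.simple i)
  have h2 := cs.length_mul_simple p i
  rw [← mul_assoc, ← mul_assoc, mul_inv_cancel, one_mul] at h1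
  unfold IsPrefix at h
  exact ⟨i, by unfold IsRightDescent; omega, by unfold IsPrefix; rw [← mul_assoc]; omega⟩

/-- A nonempty convex set is gated if any two lower neighbours in it of one of its elements have a
common prefix in it. -/
theorem isGated_of_isConvex {X : Set W} (hne : X.Nonempty) (hX : cs.IsConvex X)
    (hpeak : ∀ p ∈ X, ∀ i j, cs.IsRightDescent p i → cs.IsRightDescent p j →
      p * cs.simple i ∈ X → p * cs.simple j ∈ X →
        ∃ m ∈ X, cs.IsPrefix m (p * cs.simple i) ∧ cs.IsPrefix m (p * cs.simple j)) :
    cs.IsGated X := by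
  -- The minimal elements of X in the weak order; the gate will be any one of them.
  let N : Set W := {g | g ∈ X ∧ ∀ h ∈ X, cs.IsPrefix h g → h = g}
  have hex : ∀ p ∈ X, ∃ g ∈ N, cs.IsPrefix g p := by
    intro p hp
    obtain ⟨g, ⟨hgX, hgp⟩, hmin⟩ := (measure cs.length).wf.has_min
      {g | g ∈ X ∧ cs.IsPrefix g p} ⟨p, hp, .refl cs p⟩
    exact ⟨g, ⟨hgX, fun h hh hpre => hpre.eq_of_length_le
      (not_lt.1 (hmin h ⟨hh, hpre.trans hgp⟩))⟩, hgp⟩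
  have hdown : ∀ g ∈ N, ∀ p ∈ X, cs.IsPrefix g p → g ≠ p →
      ∃ i, cs.IsRightDescent p i ∧ p * cs.simple i ∈ X ∧ cs.IsPrefix g (p * cs.simple i) := by
    intro g hg p hp hgp hne
    obtain ⟨i, hi, hgi⟩ := cs.exists_isPrefix_mul_simple hgp hne
    refine ⟨i, hi, ?_, hgi⟩
    have := hX.mul_mem (y := g) (a := g⁻¹ * (p * cs.simple i)) (b := cs.simple i) hg.1
      (by simpa [mul_assoc] using hp) (by
        have h1 := cs.isRightDescent_iff.1 hi
        unfold IsPrefix at hgp hgi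
        rw [mul_assoc, simple_mul_simple_cancel_right, length_simple]
        omega)
    simpa using this
  -- Newman's diamond argument: the common prefix m of two lower neighbours lies above some minimal
  -- k, and induction identifies both g and g' with k.
  have huniq : ∀ n, ∀ p ∈ X, cs.length p = n → ∀ g ∈ N, ∀ g' ∈ N, cs.IsPrefix g p →
      cs.IsPrefix g' p → g = g' := by
    intro n
    induction n using Nat.strong_induction_on with
    | _ n ih =>
    rintro p hp rfl g hg g' hg' hgp hg'p
    by_cases hpN : p ∈ N
    · rw [hpN.2 g hg.1 hgp, hpN.2 g' hg'.1 hg'p]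
    obtain ⟨i, hi, hiX, hgi⟩ := hdown g hg p hp hgp (by rintro rfl; exact hpN hg)
    obtain ⟨j, hj, hjX, hgj⟩ := hdown g' hg' p hp hg'p (by rintro rfl; exact hpN hg')
    obtain ⟨m, hm, hmi, hmj⟩ := hpeak p hp i j hi hj hiX hjX
    obtain ⟨k, hk, hkm⟩ := hex m hm
    rw [ih _ hi _ hiX rfl g hg k hk hgi (hkm.trans hmi),
      ih _ hj _ hjX rfl g' hg' k hk hgj (hkm.trans hmj)]
  have hpre : ∀ p i, cs.IsPrefix p (p * cs.simple i) ∨ cs.IsPrefix (p * cs.simple i) p := by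
    intro p i
    have := cs.length_mul_simple p i
    simp only [IsPrefix, inv_mul_cancel_left, mul_inv_rev, inv_mul_cancel_right, inv_simple,
      length_simple]
    omega
  obtain ⟨x, hx⟩ := hne
  obtain ⟨g, hg, -⟩ := hex x hx
  -- Follow a geodesic from g, which stays in X by convexity. At a downward step, a minimal element
  -- below the new vertex is also below the old one, so it equals g by `huniq`.
  have hall : ∀ a : W, g * a ∈ X → cs.IsPrefix g (g * a) := by
    intro a
    induction a using cs.induction_on_length with
    | one => intro _; simpa using IsPrefix.refl cs g
    | mul a i hai ih =>
      intro hz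
      have hy : g * a ∈ X := hX.mul_mem hg.1 hz (by
        rw [length_simple]; exact cs.not_isRightDescent_iff.1 hai)
      have hga := ih hy
      rw [← mul_assoc] at hz ⊢
      obtain ⟨k, hk, hkz⟩ := hex _ hz
      obtain h | h := hpre (g * a) i
      · exact hga.trans h
      · obtain rfl := huniq _ _ hy rfl g hg k hk hga (hkz.trans h)
        exact hkz
  have hall' : ∀ y ∈ X, cs.IsPrefix g y := fun y hy => by
    simpa using hall (g⁻¹ * y) (by simpa using hy)
  refine ⟨g, ⟨hg.1, fun y hy hne => ?_⟩, hall'⟩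
  by_contra hcon
  exact hne ((hall' y hy).eq_of_length_le (not_lt.1 hcon)).symm

/-! ### Witnesses of boundary roots -/

theorem mem_witnesses_iff {x y : W} {β : B →₀ ℝ} :
    y ∈ cs.witnesses x β ↔ cs.inversionSet x ∩ cs.inversionSet y = {β} := Iff.rfl

theorem mem_witnesses_comm {x y : W} {β : B →₀ ℝ} :
    y ∈ cs.witnesses x β ↔ x ∈ cs.witnesses y β := by
  rw [mem_witnesses_iff, mem_witnesses_iff, Set.inter_comm]

theorem mem_inversionSet_of_mem_witnesses {x y : W} {β : B →₀ ℝ} (h : y ∈ cs.witnesses x β) :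
    β ∈ cs.inversionSet x ∧ β ∈ cs.inversionSet y :=
  (Set.ext_iff.1 h β).2 rfl

theorem mem_witnesses_of_subset {x y z : W} {β : B →₀ ℝ} (h : y ∈ cs.witnesses x β)
    (hz : β ∈ cs.inversionSet z) (hsub : cs.inversionSet z ⊆ cs.inversionSet y) :
    z ∈ cs.witnesses x β := by
  refine Set.Subset.antisymm ?_ ?_
  · rw [← cs.mem_witnesses_iff.1 h]
    exact Set.inter_subset_inter_right _ hsub
  · rintro _ rfl
    exact ⟨(cs.mem_inversionSet_of_mem_witnesses h).1, hz⟩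

theorem isConvex_witnesses (x : W) (β : B →₀ ℝ) : cs.IsConvex (cs.witnesses x β) := by
  intro y hy z hz ω hω e j _
  have hab : cs.wordProd (ω.take j) * cs.wordProd (ω.drop j) = y⁻¹ * z := by
    rw [← wordProd_append, List.take_append_drop, e]
  have hlen : cs.length (cs.wordProd (ω.take j) * cs.wordProd (ω.drop j)) =
      cs.length (cs.wordProd (ω.take j)) + cs.length (cs.wordProd (ω.drop j)) := by
    rw [← wordProd_append, List.take_append_drop, hω.eq, (hω.take j).eq, (hω.drop j).eq,
      ← List.length_append, List.take_append_drop]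
  obtain ⟨h1, h2⟩ := cs.inversionSet_of_length_add (y := y) hlen
  rw [hab, mul_inv_cancel_left] at h1 h2
  have hβy := cs.mem_inversionSet_of_mem_witnesses hy
  have hβz := cs.mem_inversionSet_of_mem_witnesses hz
  refine Set.Subset.antisymm ?_ ?_
  · rintro γ ⟨hγx, hγ⟩
    obtain h | h := h2 hγ
    · exact (Set.ext_iff.1 hy γ).1 ⟨hγx, h⟩
    · exact (Set.ext_iff.1 hz γ).1 ⟨hγx, h⟩
  · rintro _ rfl
    exact ⟨hβy.1, h1 ⟨hβy.2, hβz.2⟩⟩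

/-- If two lower neighbours of p are witnesses, their descent roots differ from β, so x⁻¹ keeps them
positive. Were β not an inversion of the common prefix m, it would be a nonnegative combination of
these roots, contradicting x⁻¹β < 0. -/
theorem isGated_witnesses {x : W} {β : B →₀ ℝ} (hne : (cs.witnesses x β).Nonempty) :
    cs.IsGated (cs.witnesses x β) := by
  refine cs.isGated_of_isConvex hne (cs.isConvex_witnesses x β) ?_
  intro p hp i j hi hj hiX hjX
  obtain ⟨m, hmi, hmj, hm⟩ := cs.exists_isPrefix_of_isRightDescent hi hj
  obtain ⟨hβx, hβp⟩ := cs.mem_inversionSet_of_mem_witnesses hp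
  refine ⟨m, ?_, hmi, hmj⟩
  refine cs.mem_witnesses_of_subset hiX ?_ (cs.isPrefix_iff.1 hmi)
  by_contra hβm
  obtain ⟨a, b, ha, hb, e⟩ := hm β hβp hβm
  have hdesc : ∀ k, cs.IsRightDescent p k → p * cs.simple k ∈ cs.witnesses x β →
      0 ≤ cs.geomRep x⁻¹ (-cs.geomRep p (simpleRoot k)) := by
    intro k hk hkX
    have hkp := cs.neg_geomRep_simpleRoot_mem_inversionSet hk
    refine ((cs.not_mem_inversionSet_iff hkp.1).1 fun hkx => ?_).2
    have e : _ = β := (Set.ext_iff.1 hp _).1 ⟨hkx, hkp⟩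
    have := (cs.mem_inversionSet_of_mem_witnesses hkX).2
    rw [cs.inversionSet_mul_simple_of_isRightDescent hk, e] at this
    exact this.2 rfl
  refine cs.not_mem_negRoots_of_mem_posRoots ⟨hβx.2.1, ?_⟩ hβx.2
  change 0 ≤ cs.geomRep x⁻¹ β
  rw [e, map_add, map_smul, map_smul]
  exact add_nonneg (smul_nonneg ha (hdesc i hi hiX)) (smul_nonneg hb (hdesc j hj hjX))

theorem neg_geomRep_simpleRoot_eq_of_isUniqueMinLength {x y : W} {β : B →₀ ℝ}
    (h : cs.IsUniqueMinLength (cs.witnesses x β) y) {i : B} (hi : cs.IsRightDescent y i) :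
    -cs.geomRep y (simpleRoot i) = β := by
  by_contra hne
  have hmem : y * cs.simple i ∈ cs.witnesses x β := by
    refine cs.mem_witnesses_of_subset h.1 ?_ ?_ <;>
      rw [cs.inversionSet_mul_simple_of_isRightDescent hi]
    · exact ⟨(cs.mem_inversionSet_of_mem_witnesses h.1).2, fun e => hne e.symm⟩
    · exact Set.sdiff_subset
  have hlt : cs.length (y * cs.simple i) < cs.length y := hi
  have := h.2 _ hmem fun e => by rw [e] at hlt; exact lt_irrefl _ hlt
  omega

theorem exists_isRightDescent_of_mem_inversionSet {y : W} {β : B →₀ ℝ}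
    (h : β ∈ cs.inversionSet y) : ∃ i, cs.IsRightDescent y i := by
  refine cs.exists_rightDescent_of_ne_one ?_
  rintro rfl
  simp [inversionSet_one] at h

theorem rightDescentRoots_eq_of_isUniqueMinLength {x y : W} {β : B →₀ ℝ}
    (h : cs.IsUniqueMinLength (cs.witnesses x β) y) : cs.rightDescentRoots y = {β} := by
  ext γ
  constructor
  · rintro ⟨i, hi, rfl⟩
    exact cs.neg_geomRep_simpleRoot_eq_of_isUniqueMinLength h hi
  · rintro rfl
    obtain ⟨i, hi⟩ := cs.exists_isRightDescent_of_mem_inversionSet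
      (cs.mem_inversionSet_of_mem_witnesses h.1).2
    exact ⟨i, hi, (cs.neg_geomRep_simpleRoot_eq_of_isUniqueMinLength h hi).symm⟩

/-- The shortest witness of `β` with respect to `w` is a witness with respect to every element of
the same cone type part. -/
theorem mem_witnesses_of_coneType_eq {w x y : W} {β : B →₀ ℝ}
    (h : cs.IsUniqueMinLength (cs.witnesses w β) y) (hT : cs.coneType w⁻¹ = cs.coneType x⁻¹) :
    y ∈ cs.witnesses x β := by
  obtain ⟨hβw, hβy⟩ := cs.mem_inversionSet_of_mem_witnesses h.1
  obtain ⟨i, hi⟩ := cs.exists_isRightDescent_of_mem_inversionSet hβy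
  have hΦ := cs.inversionSet_mul_simple_of_isRightDescent hi
  rw [cs.neg_geomRep_simpleRoot_eq_of_isUniqueMinLength h hi] at hΦ
  -- The two facts that y s_i is in the cone type and y is not depend only on the cone type. For x
  -- they say that Φ(x) ∩ Φ(y) is nonempty and contained in {β}.
  have hyi : y * cs.simple i ∈ cs.coneType w⁻¹ := by
    rw [mem_coneType_inv_iff, hΦ, ← Set.inter_sdiff_assoc, cs.mem_witnesses_iff.1 h.1,
      Set.sdiff_self]
  have hy : y ∉ cs.coneType w⁻¹ := by
    rw [mem_coneType_inv_iff, cs.mem_witnesses_iff.1 h.1]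
    exact Set.singleton_ne_empty β
  rw [hT, mem_coneType_inv_iff] at hyi hy
  rw [hΦ, ← Set.inter_sdiff_assoc, Set.sdiff_eq_empty] at hyi
  exact (Set.subset_singleton_iff_eq.1 hyi).resolve_left hy

/-- The boundary condition supplies a witness only for some w in the part of x; the shortest witness
for w transfers to x, while an arbitrary one need not. -/
theorem witnesses_nonempty_of_mem_boundaryRoots {x : W} {β : B →₀ ℝ}
    (h : β ∈ cs.boundaryRoots (cs.coneType x⁻¹)) : (cs.witnesses x β).Nonempty := by
  obtain ⟨-, y, w, hw, hy⟩ := h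
  obtain ⟨g, hg, -⟩ := cs.isGated_witnesses (x := w) ⟨y, hy⟩
  exact ⟨g, cs.mem_witnesses_of_coneType_eq hg hw⟩

theorem mem_gates_of_isGateOf_witnesses {x y : W} {β : B →₀ ℝ}
    (h : cs.IsGateOf (cs.witnesses x β) y) : y ∈ cs.gates := by
  have hpre : ∀ z ∈ cs.conePart (cs.coneType y⁻¹), cs.IsPrefix y z := by
    intro z hz
    -- Being the shortest partner of y, x' is also a partner of z, so y and z are both witnesses for
    -- x'. The gate y' of those witnesses is a prefix of y, hence a witness for x, and minimality of
    -- y yields y ⪯ y' ⪯ z.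
    obtain ⟨x', hx', hpre'⟩ := cs.isGated_witnesses ⟨x, cs.mem_witnesses_comm.1 h.1.1⟩
    have hzx : z ∈ cs.witnesses x' β :=
      cs.mem_witnesses_comm.1 (cs.mem_witnesses_of_coneType_eq hx' hz.symm)
    have hyx : y ∈ cs.witnesses x' β := cs.mem_witnesses_comm.1 hx'.1
    obtain ⟨y', hy', hpre''⟩ := cs.isGated_witnesses ⟨z, hzx⟩
    have hy'x : y' ∈ cs.witnesses x β := cs.mem_witnesses_of_subset h.1.1
      (cs.mem_inversionSet_of_mem_witnesses hy'.1).2 (cs.isPrefix_iff.1 (hpre'' y hyx))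
    exact (h.2 y' hy'x).trans (hpre'' z hzx)
  refine ⟨y⁻¹, ⟨rfl, fun z hz hne => ?_⟩, hpre⟩
  by_contra hcon
  exact hne ((hpre z hz).eq_of_length_le (not_lt.1 hcon)).symm

end CoxeterSystem

theorem theorem1p2 {B : Type*} [Finite B] {M : CoxeterMatrix B} {W : Type*} [Group W]
    (cs : CoxeterSystem M W) (x : W) (β : B →₀ ℝ)
    (hβ : β ∈ cs.boundaryRoots (cs.coneType x⁻¹)) :
    (∃ y : W, cs.IsUniqueMinLength (cs.witnesses x β) y ∧ y ∈ cs.tightGates) ∧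
      cs.IsConvex (cs.witnesses x β) ∧ cs.IsGated (cs.witnesses x β) := by
  have hgated := cs.isGated_witnesses (cs.witnesses_nonempty_of_mem_boundaryRoots hβ)
  obtain ⟨y, hy⟩ := id hgated
  refine ⟨⟨y, hy.1, cs.mem_gates_of_isGateOf_witnesses hy, ?_⟩,
    cs.isConvex_witnesses x β, hgated⟩
  rw [cs.rightDescentRoots_eq_of_isUniqueMinLength hy.1, Set.ncard_singleton]
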